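/- Let $M$ be a compact oriented smooth manifold of dimension $4$ (Hausdorff, without boundary, not necessarily connected), and let $\alpha$ be the standard volume form of the unit sphere $S^4\subset\mathbb{R}^5$, that is, $\alpha_y(v_1,\dots,v_4)=\det(y,v_1,\dots,v_4)$. For a smooth map $\psi:M\to S^4$ denote by $\psi^{\#}(\alpha)$ the pullback of $\alpha$ by $\psi$. Let $\phi:M\to S^4$ be a smooth map such that $\phi^{\#}(\alpha)(x)\ge 0$ for all $x\in M$ (with respect to the orientation of $M$), and assume that $\phi^{\#}(\alpha)$ does not vanish identically on any connected component of $M$. Let $R=\{x\in M \mid \phi^{\#}(\alpha)(x)=0\}$. Then there exists a smooth map $\phi':M\to S^4$ such that the $4$-form $\phi^{\#}(\alpha)+\phi'^{\#}(\alpha)$ vanishes nowhere on $M$ if and only if there exist an open neighborhood $V$ of $R$ in $M$ and a smooth immersion $f:V\to\mathbb{R}^4$. Moreover, if this condition is fulfilled, then $\phi'$ (smooth, with $\phi^{\#}(\alpha)+\phi'^{\#}(\alpha)$ vanishing nowhere) can be chosen of topological degree $0$, the degree being the signed number of preimages of a regular value. -/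

import Mathlib

open scoped Manifold ContDiff Topology

noncomputable section

/-- The unit sphere `S^n` in `ℝ^(n+1)`, with Mathlib's smooth structure. -/
abbrev UnitSphere (n : ℕ) : Type := Metric.sphere (0 : EuclideanSpace ℝ (Fin (n + 1))) 1

/-- The differential at `y` of the inclusion of `S^n` into `ℝ^(n+1)`. -/
def sphereInclusionDeriv (n : ℕ) (y : UnitSphere n) :
    TangentSpace (𝓡 n) y →ₗ[ℝ] EuclideanSpace ℝ (Fin (n + 1)) :=
  (mfderiv (𝓡 n) 𝓘(ℝ, EuclideanSpace ℝ (Fin (n + 1)))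
    (Subtype.val : UnitSphere n → EuclideanSpace ℝ (Fin (n + 1))) y).toLinearMap

/-- The standard volume form of the round sphere `S^n`, oriented as the boundary of the unit ball:
`α_y (v₁, …, v_n) = det (y, v₁, …, v_n)`. -/
def sphereVolumeForm (n : ℕ) (y : UnitSphere n) :
    TangentSpace (𝓡 n) y [⋀^Fin n]→ₗ[ℝ] ℝ :=
  ((EuclideanSpace.basisFun (Fin (n + 1)) ℝ).toBasis.det.curryLeft
    (y : EuclideanSpace ℝ (Fin (n + 1)))).compLinearMap (sphereInclusionDeriv n y)

/-- The value at `x` of the pullback `φ^# α` of the volume form `α` of `S^n` by `φ : M → S^n`. -/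
def pullbackVolumeForm {n : ℕ} {M : Type*} [TopologicalSpace M]
    [ChartedSpace (EuclideanSpace ℝ (Fin n)) M] (φ : M → UnitSphere n) (x : M) :
    TangentSpace (𝓡 n) x [⋀^Fin n]→ₗ[ℝ] ℝ :=
  (sphereVolumeForm n (φ x)).compLinearMap (mfderiv (𝓡 n) (𝓡 n) φ x).toLinearMap

/-- An orientation of a smooth `n`-manifold `M`: an orientation of each tangent space which is
locally constant, meaning that near each `x₀`, the trivialization of the tangent bundle given by the
preferred chart at `x₀` carries it to one fixed orientation of `ℝ^n`. -/
structure ManifoldOrientation (n : ℕ) (M : Type*) [TopologicalSpace M]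
    [ChartedSpace (EuclideanSpace ℝ (Fin n)) M] [IsManifold (𝓡 n) ∞ M] where
  at_point : ∀ x : M, Orientation ℝ (TangentSpace (𝓡 n) x) (Fin n)
  locally_constant : ∀ x₀ : M, ∃ o : Orientation ℝ (EuclideanSpace ℝ (Fin n)) (Fin n),
    ∀ᶠ x in 𝓝 x₀, ∀ hx : x ∈ (trivializationAt (EuclideanSpace ℝ (Fin n))
        (TangentSpace (𝓡 n) : M → Type) x₀).baseSet,
      Orientation.map (Fin n)
        ((trivializationAt (EuclideanSpace ℝ (Fin n))
          (TangentSpace (𝓡 n) : M → Type) x₀).linearEquivAt ℝ x hx) (at_point x) = o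

section AlternatingForms

variable {n : ℕ} {E : Type*} [AddCommGroup E] [Module ℝ E]

/-- A top-degree form is nonnegative if its value on every positively oriented basis is. -/
def FormNonneg (o : Orientation ℝ E (Fin n)) (η : E [⋀^Fin n]→ₗ[ℝ] ℝ) : Prop :=
  ∀ b : Module.Basis (Fin n) ℝ E, b.orientation = o → 0 ≤ η b

open Classical in
/-- The sign (`1`, `-1` or `0`) of a top-degree form on an oriented vector space. -/
def formSign (o : Orientation ℝ E (Fin n)) (η : E [⋀^Fin n]→ₗ[ℝ] ℝ) : ℤ :=
  if η = 0 then 0 else if FormNonneg o η then 1 else -1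

end AlternatingForms

section Degree

variable {n : ℕ} {M : Type*} [TopologicalSpace M]
  [ChartedSpace (EuclideanSpace ℝ (Fin n)) M] [IsManifold (𝓡 n) ∞ M]

/-- `y` is a regular value of `φ : M → S^n`: the differential of `φ` is surjective at every point
of the fibre over `y`. -/
def IsRegularValue (φ : M → UnitSphere n) (y : UnitSphere n) : Prop :=
  ∀ x : M, φ x = y → Function.Surjective (mfderiv (𝓡 n) (𝓡 n) φ x)

/-- The number of points in the fibre of `φ` over `y`, each counted with the sign `1` or `-1`
according to whether the differential of `φ` preserves or reverses the orientation there.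
(For smooth `φ` on compact `M` and a regular value `y` the fibre is finite.) -/
def signedFibreCount (o : ManifoldOrientation n M) (φ : M → UnitSphere n) (y : UnitSphere n) : ℤ :=
  ∑ᶠ x ∈ φ ⁻¹' {y}, formSign (o.at_point x) (pullbackVolumeForm φ x)

/-- The smooth map `φ : M → S^n` from a compact oriented `n`-manifold has (Brouwer) degree `d`: the
signed number of preimages of a regular value is `d`. Regular values exist, and for `n ≥ 1` the
count is the same for all of them. -/
def HasDegree (o : ManifoldOrientation n M) (φ : M → UnitSphere n) (d : ℤ) : Prop :=
  ∃ y : UnitSphere n, IsRegularValue φ y ∧ (φ ⁻¹' {y}).Finite ∧ signedFibreCount o φ y = d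

end Degree

end

/-! Since source and target have the same dimension, `pullbackVolumeForm φ x` is nonzero exactly
when the differential of `φ` at `x` is injective. Both directions work for every dimension `n ≥ 2`.

Necessity. If the sum with the form of `ψ` vanishes nowhere, then `ψ` is immersive on the open set
`V` where its own form is nonzero, and `V` contains `R`. To replace the sphere by Euclidean space it
suffices that `ψ` miss some `p` on `R`, for then stereographic projection from `p` applies near `R`.
The fibre over `p` meets `R` in finitely many points, which are removed one at a time
(`exists_avoiding`) by precomposing `ψ` with an immersive injection supported in `V` away from the
rest of the fibre. Such a map can carry a point outside `R` to the given fibre point because `R`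
contains no component of `M` (`exists_push_notMem`).

Sufficiency. Make the immersion orientation preserving by a reflection where needed, cut it off to a
smooth `g` on `M`, and take `φ' = ι ∘ (ε • g)`, with `ι` an orientation preserving embedding of
`ℝ^n` onto a punctured sphere. Near `R` the form of `φ'` is positive and that of `φ` is nonnegative;
away from `R` the form of `φ'` is of order `ε ^ n`, so by compactness a small `ε` works
(`exists_small_map_sum_ne_zero`). As `φ'` misses a point, its degree is `0`. -/

noncomputable section

/-! ### Nonvanishing of the pulled-back volume form -/

section PullbackForm

variable {n : ℕ} {M : Type*} [TopologicalSpace M] [ChartedSpace (EuclideanSpace ℝ (Fin n)) M]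

theorem contMDiff_unitSphere_val (n : ℕ) (m : ℕ∞ω) :
    ContMDiff (𝓡 n) 𝓘(ℝ, EuclideanSpace ℝ (Fin (n + 1))) m
      (Subtype.val : UnitSphere n → EuclideanSpace ℝ (Fin (n + 1))) :=
  haveI := Fact.mk (@finrank_euclideanSpace_fin ℝ _ (n + 1))
  contMDiff_coe_sphere

theorem mfderiv_unitSphere_val_injective (y : UnitSphere n) :
    Function.Injective (sphereInclusionDeriv n y) :=
  haveI := Fact.mk (@finrank_euclideanSpace_fin ℝ _ (n + 1))
  injective_mvfderiv_subtypeVal_sphere y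

theorem range_sphereInclusionDeriv (y : UnitSphere n) :
    (sphereInclusionDeriv n y).range = (ℝ ∙ (y : EuclideanSpace ℝ (Fin (n + 1))))ᗮ :=
  haveI := Fact.mk (@finrank_euclideanSpace_fin ℝ _ (n + 1))
  range_mvfderiv_subtypeVal y

/-- The pullback of the volume form, written as a determinant in the ambient space. -/
theorem pullbackVolumeForm_apply {φ : M → UnitSphere n} {x : M}
    (hφ : MDifferentiableAt (𝓡 n) (𝓡 n) φ x) (v : Fin n → TangentSpace (𝓡 n) x) :
    pullbackVolumeForm φ x v =
      (EuclideanSpace.basisFun (Fin (n + 1)) ℝ).toBasis.det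
        (Matrix.vecCons (φ x : EuclideanSpace ℝ (Fin (n + 1))) fun i =>
          mfderiv (𝓡 n) 𝓘(ℝ, EuclideanSpace ℝ (Fin (n + 1)))
            (fun z => (φ z : EuclideanSpace ℝ (Fin (n + 1)))) x (v i)) := by
  have h : mfderiv (𝓡 n) 𝓘(ℝ, EuclideanSpace ℝ (Fin (n + 1)))
      (fun z => (φ z : EuclideanSpace ℝ (Fin (n + 1)))) x = _ :=
    mfderiv_comp x ((contMDiff_unitSphere_val n 1).mdifferentiableAt one_ne_zero) hφ
  rw [h]
  rfl

/-- The inclusion embeds the tangent space onto the orthogonal complement of `y`, so `y` and the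
images of independent tangent vectors form a basis of the ambient space. -/
theorem sphereVolumeForm_apply_ne_zero (y : UnitSphere n)
    {v : Fin n → TangentSpace (𝓡 n) y} (hv : LinearIndependent ℝ v) :
    sphereVolumeForm n y v ≠ 0 := by
  have hy : (y : EuclideanSpace ℝ (Fin (n + 1))) ≠ 0 := ne_zero_of_mem_unit_sphere y
  have hli : LinearIndependent ℝ (Matrix.vecCons (y : EuclideanSpace ℝ (Fin (n + 1)))
      fun i => sphereInclusionDeriv n y (v i)) := by
    refine linearIndependent_finCons.2 ⟨?_, ?_⟩
    · exact hv.map' _ (LinearMap.ker_eq_bot.2 (mfderiv_unitSphere_val_injective y))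
    · intro hmem
      have hsub : Submodule.span ℝ (Set.range fun i => sphereInclusionDeriv n y (v i)) ≤
          (ℝ ∙ (y : EuclideanSpace ℝ (Fin (n + 1))))ᗮ := by
        rw [← range_sphereInclusionDeriv, Submodule.span_le]
        rintro _ ⟨i, rfl⟩
        exact ⟨_, rfl⟩
      exact hy (inner_self_eq_zero.1
        (Submodule.mem_orthogonal_singleton_iff_inner_right.1 (hsub hmem)))
  have := (Module.Basis.is_basis_iff_det
    (EuclideanSpace.basisFun (Fin (n + 1)) ℝ).toBasis).1
    ⟨hli, hli.span_eq_top_of_card_eq_finrank' (by simp)⟩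
  exact this.ne_zero

theorem pullbackVolumeForm_apply_ne_zero {φ : M → UnitSphere n} {x : M}
    (hφ : Function.Injective (mfderiv (𝓡 n) (𝓡 n) φ x))
    {v : Fin n → TangentSpace (𝓡 n) x} (hv : LinearIndependent ℝ v) :
    pullbackVolumeForm φ x v ≠ 0 :=
  sphereVolumeForm_apply_ne_zero (φ x)
    (hv.map' (mfderiv (𝓡 n) (𝓡 n) φ x).toLinearMap (LinearMap.ker_eq_bot.2 hφ))

theorem pullbackVolumeForm_ne_zero_iff {φ : M → UnitSphere n} {x : M} :
    pullbackVolumeForm φ x ≠ 0 ↔ Function.Injective (mfderiv (𝓡 n) (𝓡 n) φ x) := by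
  let b : Module.Basis (Fin n) ℝ (TangentSpace (𝓡 n) x) :=
    (EuclideanSpace.basisFun (Fin n) ℝ).toBasis
  refine ⟨fun h => ?_, fun h h0 => ?_⟩
  · have hb : pullbackVolumeForm φ x b ≠ 0 := fun h0 => h (by
      rw [AlternatingMap.eq_smul_basis_det b (pullbackVolumeForm φ x), h0, zero_smul])
    have hli : LinearIndependent ℝ fun i => (mfderiv (𝓡 n) (𝓡 n) φ x).toLinearMap (b i) := by
      by_contra hc
      exact hb ((sphereVolumeForm n (φ x)).map_linearDependent _ hc)
    have hinj := b.injective_constr_of_linearIndependent (R₂ := ℝ) hli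
    rwa [b.constr_self] at hinj
  · exact pullbackVolumeForm_apply_ne_zero h b.linearIndependent (by rw [h0]; rfl)

end PullbackForm

/-! ### Local frames and continuity of top-degree forms -/

section Frame

variable {n : ℕ} {M : Type*} [TopologicalSpace M] [ChartedSpace (EuclideanSpace ℝ (Fin n)) M]
  [IsManifold (𝓡 n) ∞ M]

/-- The vectors at `x` which the trivialization of the tangent bundle given by the preferred chart
at `x₀` sends to the basis `β`. -/
def localFrame (x₀ : M) (β : Module.Basis (Fin n) ℝ (EuclideanSpace ℝ (Fin n))) (x : M)
    (i : Fin n) : TangentSpace (𝓡 n) x :=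
  (trivializationAt (EuclideanSpace ℝ (Fin n)) (TangentSpace (𝓡 n) : M → Type) x₀).symmL ℝ x (β i)

/-- The differential is continuous in tangent coordinates. For a vector space target the coordinate
change there is trivial, so only the trivialization on the source remains. -/
theorem continuousAt_mfderiv_symmL {F : Type*} [NormedAddCommGroup F] [NormedSpace ℝ F]
    {G : M → F} {x₀ : M} (hG : ContMDiffAt (𝓡 n) 𝓘(ℝ, F) ∞ G x₀)
    (w : EuclideanSpace ℝ (Fin n)) :
    ContinuousAt (fun x => (mfderiv (𝓡 n) 𝓘(ℝ, F) G x
      ((trivializationAt (EuclideanSpace ℝ (Fin n))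
        (TangentSpace (𝓡 n) : M → Type) x₀).symmL ℝ x w) : F)) x₀ := by
  have h := (hG.mfderiv_const (m := 0) (by simp)).continuousAt
  have h2 : ContinuousAt (fun x => inTangentCoordinates (𝓡 n) 𝓘(ℝ, F) id G
      (mfderiv (𝓡 n) 𝓘(ℝ, F) G) x₀ x w) x₀ := h.clm_apply continuousAt_const
  refine h2.congr ?_
  filter_upwards [(chartAt (EuclideanSpace ℝ (Fin n)) x₀).open_source.mem_nhds
    (mem_chart_source _ x₀)] with x hx
  have h3 : inTangentCoordinates (𝓡 n) 𝓘(ℝ, F) id G (mfderiv (𝓡 n) 𝓘(ℝ, F) G) x₀ x = _ :=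
    inTangentCoordinates_eq id G (mfderiv (𝓡 n) 𝓘(ℝ, F) G) hx (Set.mem_univ _)
  rw [TangentBundle.symmL_trivializationAt_eq_core hx]
  refine (DFunLike.congr_fun h3 w).trans ?_
  simp only [TangentBundle.coordChange_model_space]
  rfl

theorem localFrame_eq_map {x₀ x : M}
    (hx : x ∈ (trivializationAt (EuclideanSpace ℝ (Fin n))
      (TangentSpace (𝓡 n) : M → Type) x₀).baseSet)
    (β : Module.Basis (Fin n) ℝ (EuclideanSpace ℝ (Fin n))) :
    localFrame x₀ β x = β.map ((trivializationAt (EuclideanSpace ℝ (Fin n))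
      (TangentSpace (𝓡 n) : M → Type) x₀).linearEquivAt ℝ x hx).symm := by
  ext1 i
  rw [Module.Basis.map_apply, Bundle.Trivialization.linearEquivAt_symm_apply, localFrame,
    Bundle.Trivialization.symmL_apply _ hx]

theorem eventually_mem_baseSet (x₀ : M) :
    ∀ᶠ x in 𝓝 x₀, x ∈ (trivializationAt (EuclideanSpace ℝ (Fin n))
      (TangentSpace (𝓡 n) : M → Type) x₀).baseSet :=
  (trivializationAt (EuclideanSpace ℝ (Fin n)) (TangentSpace (𝓡 n) : M → Type)
    x₀).open_baseSet.mem_nhds (FiberBundle.mem_baseSet_trivializationAt' x₀)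

theorem continuous_basisFun_det (m : ℕ) :
    Continuous fun v : Fin m → EuclideanSpace ℝ (Fin m) =>
      (EuclideanSpace.basisFun (Fin m) ℝ).toBasis.det v := by
  simp only [Module.Basis.det_apply]
  refine Continuous.matrix_det (continuous_matrix fun i j => ?_)
  simp only [Module.Basis.toMatrix_apply, OrthonormalBasis.coe_toBasis_repr_apply,
    EuclideanSpace.basisFun_repr]
  fun_prop

theorem continuousAt_det_mfderiv_localFrame {G : M → EuclideanSpace ℝ (Fin n)} {x₀ : M}
    (hG : ContMDiffAt (𝓡 n) (𝓡 n) ∞ G x₀)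
    (β : Module.Basis (Fin n) ℝ (EuclideanSpace ℝ (Fin n))) :
    ContinuousAt (fun x => (EuclideanSpace.basisFun (Fin n) ℝ).toBasis.det
      fun i => mfderiv (𝓡 n) (𝓡 n) G x (localFrame x₀ β x i)) x₀ := by
  have h : ContinuousAt (fun x => (fun i => mfderiv (𝓡 n) (𝓡 n) G x (localFrame x₀ β x i) :
      Fin n → EuclideanSpace ℝ (Fin n))) x₀ :=
    continuousAt_pi.2 fun i => continuousAt_mfderiv_symmL hG (β i)
  exact (continuous_basisFun_det n).continuousAt.comp h

theorem continuousAt_pullbackVolumeForm_localFrame {φ : M → UnitSphere n} {x₀ : M}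
    (hφ : ContMDiff (𝓡 n) (𝓡 n) ∞ φ)
    (β : Module.Basis (Fin n) ℝ (EuclideanSpace ℝ (Fin n))) :
    ContinuousAt (fun x => pullbackVolumeForm φ x (localFrame x₀ β x)) x₀ := by
  have hc : ContMDiff (𝓡 n) 𝓘(ℝ, EuclideanSpace ℝ (Fin (n + 1))) ∞
      (fun z => (φ z : EuclideanSpace ℝ (Fin (n + 1)))) :=
    (contMDiff_unitSphere_val n ∞).comp hφ
  have h : ContinuousAt (fun x => Matrix.vecCons (φ x : EuclideanSpace ℝ (Fin (n + 1)))
      (fun i => mfderiv (𝓡 n) 𝓘(ℝ, EuclideanSpace ℝ (Fin (n + 1)))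
        (fun z => (φ z : EuclideanSpace ℝ (Fin (n + 1)))) x (localFrame x₀ β x i) :
          Fin n → EuclideanSpace ℝ (Fin (n + 1)))) x₀ := by
    refine continuousAt_pi.2 fun i => ?_
    refine Fin.cases ?_ (fun i => ?_) i
    · exact hc.continuous.continuousAt
    · exact continuousAt_mfderiv_symmL hc.contMDiffAt (β i)
  refine ((continuous_basisFun_det (n + 1)).continuousAt.comp h).congr ?_
  exact Filter.Eventually.of_forall fun x =>
    (pullbackVolumeForm_apply (hφ.mdifferentiableAt (by simp)) _).symm

theorem isOpen_pullbackVolumeForm_ne_zero {φ : M → UnitSphere n}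
    (hφ : ContMDiff (𝓡 n) (𝓡 n) ∞ φ) : IsOpen {x | pullbackVolumeForm φ x ≠ 0} := by
  refine isOpen_iff_mem_nhds.2 fun x₀ hx₀ => ?_
  let β := (EuclideanSpace.basisFun (Fin n) ℝ).toBasis
  have h0 : pullbackVolumeForm φ x₀ (localFrame x₀ β x₀) ≠ 0 := by
    rw [localFrame_eq_map (FiberBundle.mem_baseSet_trivializationAt' x₀)]
    exact pullbackVolumeForm_apply_ne_zero (pullbackVolumeForm_ne_zero_iff.1 hx₀)
      (Module.Basis.linearIndependent _)
  filter_upwards [(continuousAt_pullbackVolumeForm_localFrame hφ β).eventually_ne h0] with x hx h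
  exact hx (by rw [h]; rfl)

end Frame

/-! ### Immersions between manifolds of equal dimension -/

section Immersion

variable {n : ℕ} {M : Type*} [TopologicalSpace M] [ChartedSpace (EuclideanSpace ℝ (Fin n)) M]

theorem mfderiv_injective_of_isImmersionAt {m : ℕ} {N : Type*} [TopologicalSpace N]
    [ChartedSpace (EuclideanSpace ℝ (Fin m)) N] {f : M → N} {x : M}
    (h : Manifold.IsImmersionAt (𝓡 n) (𝓡 m) ∞ f x) :
    Function.Injective (mfderiv (𝓡 n) (𝓡 m) f x) := by
  have hφ1 : h.domChart ∈ IsManifold.maximalAtlas (𝓡 n) 1 M :=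
    IsManifold.maximalAtlas_subset_of_le (by simp) h.domChart_mem_maximalAtlas
  have hψ1 : h.codChart ∈ IsManifold.maximalAtlas (𝓡 m) 1 N :=
    IsManifold.maximalAtlas_subset_of_le (by simp) h.codChart_mem_maximalAtlas
  have hx := h.mem_domChart_source
  have hφ : h.domChart.MDifferentiable (𝓡 n) (𝓡 n) :=
    ⟨fun y hy => (mdifferentiableAt_of_mem_maximalAtlas hφ1 hy).mdifferentiableWithinAt,
      fun y hy => (mdifferentiableAt_symm_of_mem_maximalAtlas hφ1 hy).mdifferentiableWithinAt⟩
  let L : EuclideanSpace ℝ (Fin n) →L[ℝ] EuclideanSpace ℝ (Fin m) :=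
    (h.equiv : _ →L[ℝ] EuclideanSpace ℝ (Fin m)).comp (ContinuousLinearMap.inl ℝ _ h.complement)
  have hL : Function.Injective L :=
    h.equiv.injective.comp fun a b hab => congrArg Prod.fst hab
  have heq : (h.codChart ∘ f) =ᶠ[𝓝 x] (L ∘ h.domChart) := by
    filter_upwards [h.domChart.open_source.mem_nhds hx] with y hy
    have hy' : h.domChart y ∈ (h.domChart.extend (𝓡 n)).target := by
      simpa using h.domChart.map_source hy
    have key := h.writtenInCharts hy'
    simp [h.domChart.left_inv hy] at key
    exact key
  have hf : MDifferentiableAt (𝓡 n) (𝓡 m) f x := h.contMDiffAt.mdifferentiableAt (by simp)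
  have h1 : mfderiv (𝓡 n) (𝓡 m) (h.codChart ∘ f) x = _ := mfderiv_comp x
    (mdifferentiableAt_of_mem_maximalAtlas hψ1 h.mem_codChart_source) hf
  have h2 : mfderiv (𝓡 n) (𝓡 m) (L ∘ h.domChart) x = _ := mfderiv_comp x
    L.mdifferentiableAt (hφ.mdifferentiableAt hx)
  rw [heq.mfderiv_eq, h2, L.mfderiv_eq] at h1
  have hinj : Function.Injective (L ∘ mfderiv (𝓡 n) (𝓡 n) h.domChart x) :=
    hL.comp (hφ.mfderiv_injective hx)
  refine Function.Injective.of_comp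
    (f := mfderiv (𝓡 m) (𝓡 m) h.codChart (f x)) ?_
  intro a b hab
  exact hinj ((DFunLike.congr_fun h1 a).trans (hab.trans (DFunLike.congr_fun h1 b).symm))

/-- An injective endomorphism of `ℝ^n`, as a continuous linear equivalence. -/
def ContinuousLinearMap.equivOfInjective (A : EuclideanSpace ℝ (Fin n) →L[ℝ]
    EuclideanSpace ℝ (Fin n)) (hA : Function.Injective A) :
    EuclideanSpace ℝ (Fin n) ≃L[ℝ] EuclideanSpace ℝ (Fin n) :=
  (LinearEquiv.ofInjectiveEndo A.toLinearMap hA).toContinuousLinearEquiv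

theorem ContinuousLinearMap.coe_equivOfInjective (A : EuclideanSpace ℝ (Fin n) →L[ℝ]
    EuclideanSpace ℝ (Fin n)) (hA : Function.Injective A) :
    (A.equivOfInjective hA : EuclideanSpace ℝ (Fin n) →L[ℝ] EuclideanSpace ℝ (Fin n)) = A := by
  ext1 v
  rfl

variable [IsManifold (𝓡 n) ∞ M]

/-- Inverse function theorem: the local inverse of `f`, read in a chart, serves as codomain chart;
in it `f` becomes the identity and the complement is trivial. -/
theorem isImmersion_of_mfderiv_injective {f : M → EuclideanSpace ℝ (Fin n)}
    (hf : ContMDiff (𝓡 n) (𝓡 n) ∞ f)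
    (hinj : ∀ x, Function.Injective (mfderiv (𝓡 n) (𝓡 n) f x)) :
    Manifold.IsImmersion (𝓡 n) (𝓡 n) ∞ f := by
  refine Manifold.IsImmersionOfComplement.isImmersion (F := PUnit.{1}) fun x₀ => ?_
  set e := chartAt (EuclideanSpace ℝ (Fin n)) x₀ with he
  have hemax : e ∈ IsManifold.maximalAtlas (𝓡 n) ∞ M := IsManifold.chart_mem_maximalAtlas x₀
  have heD := mdifferentiable_chart (I := 𝓡 n) x₀
  set g : EuclideanSpace ℝ (Fin n) → EuclideanSpace ℝ (Fin n) := f ∘ e.symm with hg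
  have hgs : ∀ z ∈ e.target, ContDiffAt ℝ ∞ g z := fun z hz =>
    contMDiffAt_iff_contDiffAt.1 (hf.contMDiffAt.comp z
      (contMDiffAt_symm_of_mem_maximalAtlas hemax hz))
  have hgd : ∀ z ∈ e.target, Function.Injective (fderiv ℝ g z) := by
    intro z hz
    have h1 : mfderiv (𝓡 n) (𝓡 n) g z = _ := mfderiv_comp z
      (hf.mdifferentiableAt (by simp)) (heD.mdifferentiableAt_symm hz)
    rw [mfderiv_eq_fderiv] at h1
    rw [h1]
    exact (hinj _).comp (heD.symm.mfderiv_injective hz)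
  have hz₀ : e x₀ ∈ e.target := e.map_source (mem_chart_source _ x₀)
  have hstrict : HasStrictFDerivAt g
      (((fderiv ℝ g (e x₀)).equivOfInjective (hgd _ hz₀) : _ →L[ℝ] _)) (e x₀) := by
    rw [ContinuousLinearMap.coe_equivOfInjective]
    exact (hgs _ hz₀).hasStrictFDerivAt (by simp)
  -- Restricting to `e.target` keeps the differential of `g` invertible on the whole source, so the
  -- inverse is smooth everywhere on the target.
  let ψ := (hstrict.toOpenPartialHomeomorph g).restr e.target
  have hψg : ∀ z, ψ z = g z := fun z => rfl
  have hψsrc : ψ.source ⊆ e.target := by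
    intro z hz
    simp only [ψ, OpenPartialHomeomorph.restr_source, e.open_target.interior_eq] at hz
    exact hz.2
  have hψz₀ : e x₀ ∈ ψ.source := by
    simp only [ψ, OpenPartialHomeomorph.restr_source, e.open_target.interior_eq]
    exact ⟨hstrict.mem_toOpenPartialHomeomorph_source, hz₀⟩
  have hψgr : ψ ∈ contDiffGroupoid ∞ (𝓡 n) := by
    rw [contDiffGroupoid, mem_groupoid_of_pregroupoid]
    constructor
    · simp only [contDiffPregroupoid, modelWithCornersSelf_coe, modelWithCornersSelf_coe_symm,
        Function.id_comp, Function.comp_id, Set.preimage_id, Set.range_id, Set.inter_univ]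
      exact fun z hz => (hgs z (hψsrc hz)).contDiffWithinAt
    · simp only [contDiffPregroupoid, modelWithCornersSelf_coe, modelWithCornersSelf_coe_symm,
        Function.id_comp, Function.comp_id, Set.preimage_id, Set.range_id, Set.inter_univ]
      intro w hw
      have hw' := hψsrc (ψ.map_target hw)
      refine (ψ.contDiffAt_symm
        (f₀' := (fderiv ℝ g (ψ.symm w)).equivOfInjective (hgd _ hw')) hw ?_ (hgs _ hw')
        ).contDiffWithinAt
      rw [ContinuousLinearMap.coe_equivOfInjective]
      exact ((hgs _ hw').differentiableAt (by simp)).hasFDerivAt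
  have hψmax : ψ.symm ∈ IsManifold.maximalAtlas (𝓡 n) ∞ (EuclideanSpace ℝ (Fin n)) :=
    StructureGroupoid.mem_maximalAtlas_of_mem_groupoid _
      ((contDiffGroupoid ∞ (𝓡 n)).symm hψgr)
  have hgx : g (e x₀) = f x₀ := by simp [hg, e.left_inv (mem_chart_source _ x₀)]
  have hs : IsOpen (e.source ∩ e ⁻¹' ψ.source) := e.isOpen_inter_preimage ψ.open_source
  refine Manifold.IsImmersionAtOfComplement.mk_of_continuousAt hf.continuous.continuousAt
    (ContinuousLinearEquiv.prodUnique ℝ _ _) (e.restr (e.source ∩ e ⁻¹' ψ.source)) ψ.symm ?_ ?_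
    (restr_mem_maximalAtlas _ hemax hs) hψmax ?_
  · rw [e.restr_source, hs.interior_eq]
    exact ⟨mem_chart_source _ x₀, mem_chart_source _ x₀, hψz₀⟩
  · rw [← hgx, ← hψg]
    exact ψ.map_source hψz₀
  · intro z hz
    have hz1 : z ∈ e.target ∧ z ∈ ψ.source := by
      simp only [OpenPartialHomeomorph.extend_target, modelWithCornersSelf_coe_symm,
        Set.preimage_id, modelWithCornersSelf_coe, Set.range_id, Set.inter_univ,
        OpenPartialHomeomorph.restr_target, hs.interior_eq] at hz
      have := hz.2.2
      rw [Set.mem_preimage, e.right_inv hz.1] at this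
      exact ⟨hz.1, this⟩
    simpa [hψg, hg] using ψ.left_inv hz1.2

end Immersion

/-! ### Pushing points by compactly supported deformations -/

section Push

variable {n : ℕ} {M : Type*} [TopologicalSpace M] [ChartedSpace (EuclideanSpace ℝ (Fin n)) M]

/-- A smooth injective self-map of `M` with injective differential, equal to the identity
outside `Ω`. -/
structure IsPush (Ω : Set M) (h : M → M) : Prop where
  contMDiff : ContMDiff (𝓡 n) (𝓡 n) ∞ h
  injective : Function.Injective h
  mfderiv_injective : ∀ x, Function.Injective (mfderiv (𝓡 n) (𝓡 n) h x)
  eq_self : ∀ x ∉ Ω, h x = x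

theorem IsPush.mapsTo {Ω : Set M} {h : M → M} (hh : IsPush (n := n) Ω h) : Set.MapsTo h Ω Ω := by
  intro x hx
  by_contra hc
  rw [hh.injective (hh.eq_self _ hc)] at hc
  exact hc hx

theorem IsPush.id (Ω : Set M) : IsPush (n := n) Ω (_root_.id : M → M) where
  contMDiff := contMDiff_id
  injective := Function.injective_id
  mfderiv_injective x := by
    rw [mfderiv_id]
    exact Function.injective_id
  eq_self _ _ := rfl

theorem IsPush.comp {Ω : Set M} {h k : M → M} (hh : IsPush (n := n) Ω h)
    (hk : IsPush (n := n) Ω k) : IsPush (n := n) Ω (h ∘ k) where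
  contMDiff := hh.contMDiff.comp hk.contMDiff
  injective := hh.injective.comp hk.injective
  mfderiv_injective x := by
    rw [mfderiv_comp x (hh.contMDiff.mdifferentiableAt (by simp))
      (hk.contMDiff.mdifferentiableAt (by simp))]
    exact (hh.mfderiv_injective _).comp (hk.mfderiv_injective x)
  eq_self x hx := by
    rw [Function.comp_apply, hk.eq_self x hx, hh.eq_self x hx]

/-- Adding a vector cut off by a bump function of small Lipschitz constant. -/
theorem exists_euclidean_push {c : EuclideanSpace ℝ (Fin n)} {r : ℝ} (hr : 0 < r) :
    ∃ δ > 0, ∀ a ∈ Metric.ball c δ, ∀ a' ∈ Metric.ball c δ,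
      ∃ k : EuclideanSpace ℝ (Fin n) → EuclideanSpace ℝ (Fin n), ContDiff ℝ ∞ k ∧
        Function.Injective k ∧ (∀ x, Function.Injective (fderiv ℝ k x)) ∧
        (∀ x ∉ Metric.closedBall c r, k x = x) ∧ k a = a' := by
  let b : ContDiffBump c := ⟨r / 2, r, half_pos hr, half_lt_self hr⟩
  have hb : ContDiff ℝ ∞ b := b.contDiff
  obtain ⟨C, hC⟩ := ContDiff.lipschitzWith_of_hasCompactSupport b.hasCompactSupport hb (by simp)
  have hC1 : (0 : ℝ) < C + 1 := by positivity
  -- The first bound puts `a` where the bump equals `1`; the second gives `‖a' - a‖ < 1 / (C + 1)`,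
  -- where `C + 1` allows for `C = 0`.
  refine ⟨min (r / 2) (1 / (2 * (C + 1))), by positivity, fun a ha a' ha' => ?_⟩
  have hab : a ∈ Metric.closedBall c (r / 2) :=
    Metric.ball_subset_closedBall (Metric.ball_subset_ball (min_le_left _ _) ha)
  set v := a' - a with hv
  have hvC : C * ‖v‖ < 1 := by
    have h1 : ‖v‖ < 1 / (2 * (C + 1)) + 1 / (2 * (C + 1)) := by
      rw [hv, ← dist_eq_norm]
      refine (dist_triangle_right a' a c).trans_lt (add_lt_add ?_ ?_)
      · exact (Metric.mem_ball.1 ha').trans_le (min_le_right _ _)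
      · exact (Metric.mem_ball.1 ha).trans_le (min_le_right _ _)
    have h2 : 1 / (2 * ((C : ℝ) + 1)) + 1 / (2 * (C + 1)) = 1 / (C + 1) := by field_simp; norm_num
    rw [h2, lt_div_iff₀ hC1] at h1
    nlinarith [norm_nonneg v]
  -- Since `C * ‖v‖ < 1`, the perturbation cannot cancel `u`. This gives injectivity of the map,
  -- with `t = b x - b y`, and of its differential, with `t = fderiv ℝ b x u`.
  have hsmall : ∀ t : ℝ, ∀ u : EuclideanSpace ℝ (Fin n), |t| ≤ C * ‖u‖ → u + t • v = 0 →
      u = 0 := by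
    intro t u ht hu
    by_contra hne
    have hpos := norm_pos_iff.2 hne
    have h1 : ‖u‖ = |t| * ‖v‖ := by
      rw [eq_neg_of_add_eq_zero_left hu, norm_neg, norm_smul, Real.norm_eq_abs]
    nlinarith [norm_nonneg v]
  have hder : ∀ x, HasFDerivAt (fun x => x + b x • v)
      (ContinuousLinearMap.id ℝ _ + (fderiv ℝ b x).smulRight v) x := fun x =>
    (hasFDerivAt_id x).add
      ((hb.differentiable (by simp) x).hasFDerivAt.smul_const v)
  refine ⟨fun x => x + b x • v, contDiff_id.add (b.contDiff.smul contDiff_const), ?_, ?_, ?_, ?_⟩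
  · intro x y hxy
    refine sub_eq_zero.1 (hsmall (b x - b y) (x - y) ?_ ?_)
    · simpa [dist_eq_norm] using hC.dist_le_mul x y
    · have : x + b x • v = y + b y • v := hxy
      rw [sub_smul, sub_add_sub_comm, this, sub_self]
  · intro x
    rw [(hder x).fderiv]
    refine (injective_iff_map_eq_zero _).2 fun u hu => ?_
    refine hsmall (fderiv ℝ b x u) u ?_ (by simpa using hu)
    exact ((fderiv ℝ b x).le_opNorm u).trans
      (mul_le_mul_of_nonneg_right (norm_fderiv_le_of_lipschitz ℝ hC) (norm_nonneg _))
  · intro x hx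
    have : b x = 0 := b.zero_of_le_dist (by simpa using (not_le.1 hx).le)
    simp [this]
  · have : b a = 1 := b.one_of_mem_closedBall hab
    simp [this, hv]

variable [IsManifold (𝓡 n) ∞ M] [T2Space M]

/-- The Euclidean push is transported by a chart and extended by the identity; the extension is
smooth because the compact support is closed in the Hausdorff space `M`. -/
theorem exists_local_push {Ω : Set M} (hΩ : IsOpen Ω) {w : M} (hw : w ∈ Ω) :
    ∃ W ∈ 𝓝 w, ∀ z ∈ W, ∀ z' ∈ W, ∃ h : M → M, IsPush (n := n) Ω h ∧ h z = z' := by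
  classical
  set e := chartAt (EuclideanSpace ℝ (Fin n)) w with he
  have hemax : e ∈ IsManifold.maximalAtlas (𝓡 n) ∞ M := IsManifold.chart_mem_maximalAtlas w
  have heD := mdifferentiable_chart (I := 𝓡 n) w
  have hws : w ∈ e.source := mem_chart_source _ w
  obtain ⟨r, hr, hrB⟩ := Metric.nhds_basis_closedBall.mem_iff.1
    ((e.symm.isOpen_inter_preimage hΩ).mem_nhds
      (show e w ∈ e.target ∩ e.symm ⁻¹' Ω from
        ⟨e.map_source hws, by simpa [e.left_inv hws] using hw⟩))
  obtain ⟨δ, hδ, hk⟩ := exists_euclidean_push (c := e w) hr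
  refine ⟨e.source ∩ e ⁻¹' Metric.ball (e w) δ,
    (e.isOpen_inter_preimage Metric.isOpen_ball).mem_nhds ⟨hws, Metric.mem_ball_self hδ⟩,
    fun z hz z' hz' => ?_⟩
  obtain ⟨k, hks, hki, hkd, hkid, hka⟩ := hk _ hz.2 _ hz'.2
  set B := Metric.closedBall (e w) r with hB
  have hBt : B ⊆ e.target := fun x hx => (hrB hx).1
  have hkB : Set.MapsTo k B B := by
    intro x hx
    by_contra hc
    rw [hki (hkid _ hc)] at hc
    exact hc hx
  have hkt : Set.MapsTo k e.target e.target := by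
    intro x hx
    by_cases hxB : x ∈ B
    · exact hBt (hkB hxB)
    · rwa [hkid x hxB]
  have hK : IsClosed (e.symm '' B) :=
    ((isCompact_closedBall _ _).image_of_continuousOn (e.continuousOn_symm.mono hBt)).isClosed
  set h : M → M := fun y => if y ∈ e.source then e.symm (k (e y)) else y with hh
  have hsrc : ∀ y ∈ e.source, h y = e.symm (k (e y)) := fun y hy => if_pos hy
  have hoff : ∀ y ∉ e.source, h y = y := fun y hy => if_neg hy
  have hmaps : ∀ y ∈ e.source, k (e y) ∈ e.target := fun y hy => hkt (e.map_source hy)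
  have hKid : ∀ y ∉ e.symm '' B, h y = y := by
    intro y hy
    by_cases hys : y ∈ e.source
    · have : e y ∉ B := fun hyB => hy ⟨e y, hyB, e.left_inv hys⟩
      rw [hsrc y hys, hkid _ this, e.left_inv hys]
    · exact hoff y hys
  have hKs : e.symm '' B ⊆ e.source := by
    rintro _ ⟨x, hx, rfl⟩
    exact e.map_target (hBt hx)
  refine ⟨h, ⟨?_, ?_, ?_, ?_⟩, ?_⟩
  · refine contMDiff_of_contMDiffOn_union_of_isOpen (s := e.source) (t := (e.symm '' B)ᶜ)
      ?_ ?_ ?_ e.open_source hK.isOpen_compl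
    · refine ContMDiffOn.congr (f := e.symm ∘ k ∘ e) ?_ hsrc
      refine (contMDiffOn_symm_of_mem_maximalAtlas hemax).comp
        (hks.contMDiff.comp_contMDiffOn (contMDiffOn_of_mem_maximalAtlas hemax)) hmaps
    · exact contMDiffOn_id.congr hKid
    · exact Set.eq_univ_of_forall fun y => by
        by_cases hy : y ∈ e.symm '' B
        · exact Or.inl (hKs hy)
        · exact Or.inr hy
  · have hss : ∀ y ∈ e.source, h y ∈ e.source := fun y hy => by
      rw [hsrc y hy]
      exact e.map_target (hmaps y hy)
    intro y₁ y₂ h12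
    by_cases h1 : y₁ ∈ e.source <;> by_cases h2 : y₂ ∈ e.source
    · rw [hsrc _ h1, hsrc _ h2] at h12
      exact e.injOn h1 h2 (hki (e.symm.injOn (hmaps _ h1) (hmaps _ h2) h12))
    · rw [hoff y₂ h2] at h12
      exact absurd (h12 ▸ hss y₁ h1) h2
    · rw [hoff y₁ h1] at h12
      exact absurd (h12 ▸ hss y₂ h2) h1
    · rwa [hoff _ h1, hoff _ h2] at h12
  · intro y
    by_cases hy : y ∈ e.source
    · have heq : h =ᶠ[𝓝 y] e.symm ∘ (k ∘ e) := by
        filter_upwards [e.open_source.mem_nhds hy] with z hz using hsrc z hz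
      have hkm : MDifferentiableAt (𝓡 n) (𝓡 n) k (e y) :=
        (hks.differentiable (by simp) _).mdifferentiableAt
      rw [heq.mfderiv_eq, mfderiv_comp y (heD.mdifferentiableAt_symm (hmaps y hy))
        (hkm.comp y (heD.mdifferentiableAt hy)), mfderiv_comp y hkm (heD.mdifferentiableAt hy),
        mfderiv_eq_fderiv]
      exact (heD.symm.mfderiv_injective (hmaps y hy)).comp
        ((hkd _).comp (heD.mfderiv_injective hy))
    · have heq : h =ᶠ[𝓝 y] id := by
        filter_upwards [hK.isOpen_compl.mem_nhds fun hc => hy (hKs hc)] with z hz using hKid z hz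
      rw [heq.mfderiv_eq, mfderiv_id]
      exact Function.injective_id
  · intro y hy
    refine hKid y ?_
    rintro ⟨x, hx, rfl⟩
    exact hy (hrB hx).2
  · rw [hsrc z hz.1, hka, e.left_inv hz'.1]

/-- Let `O` be the set of points that some push supported in `V \ D` carries to `q`. Local pushes
make `O` open and relatively closed in `V \ D`. If `O` lay in `R`, its closure would too, and would
be clopen in `M`, so `R` would contain the component of `q`. -/
theorem exists_push_notMem (hn : 2 ≤ n) {R V D : Set M} (hR : IsClosed R) (hV : IsOpen V)
    (hRV : R ⊆ V) (hcomp : ∀ x, ∃ y ∈ connectedComponent x, y ∉ R) (hΩ : IsOpen (V \ D))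
    (hD : ∀ d ∈ D ∩ V, ∀ᶠ x in 𝓝 d, x ∈ D → x = d) {q : M} (hq : q ∈ V \ D) :
    ∃ z ∈ V \ D, z ∉ R ∧ ∃ h : M → M, IsPush (n := n) (V \ D) h ∧ h z = q := by
  set O : Set M := {z | z ∈ V \ D ∧ ∃ h : M → M, IsPush (n := n) (V \ D) h ∧ h z = q} with hO
  by_contra! hcon
  have hOR : O ⊆ R := fun z hz => by
    by_contra hzR
    obtain ⟨h, hh, hhz⟩ := hz.2
    exact hcon z hz.1 hzR h hh hhz
  have hOopen : IsOpen O := by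
    refine isOpen_iff_mem_nhds.2 fun z hz => ?_
    obtain ⟨W, hW, hloc⟩ := exists_local_push (n := n) hΩ hz.1
    obtain ⟨h, hh, hhz⟩ := hz.2
    filter_upwards [hW, hΩ.mem_nhds hz.1] with x hxW hxΩ
    obtain ⟨k, hk, hkx⟩ := hloc x hxW z (mem_of_mem_nhds hW)
    exact ⟨hxΩ, h ∘ k, hh.comp hk, by simp [hkx, hhz]⟩
  have hOclosed : closure O ∩ (V \ D) ⊆ O := by
    rintro x ⟨hxc, hxΩ⟩
    obtain ⟨W, hW, hloc⟩ := exists_local_push (n := n) hΩ hxΩ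
    obtain ⟨z, hzW, hzO⟩ := mem_closure_iff_nhds.1 hxc W hW
    obtain ⟨h, hh, hhz⟩ := hzO.2
    obtain ⟨k, hk, hkx⟩ := hloc x (mem_of_mem_nhds hW) z hzW
    exact ⟨hxΩ, h ∘ k, hh.comp hk, by simp [hkx, hhz]⟩
  have hclV : closure O ⊆ V := (closure_minimal hOR hR).trans hRV
  have hclopen : IsClopen (closure O) := by
    refine ⟨isClosed_closure, isOpen_iff_mem_nhds.2 fun x hx => ?_⟩
    by_cases hxD : x ∈ D
    -- Near `x` the set `D` is just `{x}`. A small punctured ball is connected because `n ≥ 2`,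
    -- avoids `D` and meets `O`, hence lies in `O`.
    · have hxV := hclV hx
      set e := chartAt (EuclideanSpace ℝ (Fin n)) x with he
      have hxs : x ∈ e.source := mem_chart_source _ x
      obtain ⟨U, hU, hUo, hxU⟩ := mem_nhds_iff.1 (hD x ⟨hxD, hxV⟩)
      obtain ⟨r, hr, hrB⟩ := Metric.mem_nhds_iff.1
        ((e.symm.isOpen_inter_preimage (hUo.inter hV)).mem_nhds
          (show e x ∈ e.target ∩ e.symm ⁻¹' (U ∩ V) from
            ⟨e.map_source hxs, by simpa [e.left_inv hxs] using ⟨hxU, hxV⟩⟩))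
      -- Parametrizing the ball by all of `ℝ^n` turns the punctured ball into the image of `{0}ᶜ`.
      let u := OpenPartialHomeomorph.univBall (e x) r
      have hu0 : u 0 = e x := OpenPartialHomeomorph.univBall_apply_zero _ _
      have hut : u.target = Metric.ball (e x) r := OpenPartialHomeomorph.univBall_target _ hr
      have hus : u.source = Set.univ := OpenPartialHomeomorph.univBall_source _ _
      have hub : ∀ a, u a ∈ Metric.ball (e x) r := fun a =>
        hut ▸ u.map_source (hus ▸ Set.mem_univ a)
      have hucont : Continuous u := OpenPartialHomeomorph.continuous_univBall _ _
      have hjinj : ∀ a, e.symm (u a) = x → a = 0 := by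
        intro a ha
        have h1 : u a = u 0 := by
          rw [hu0, ← ha, e.right_inv (hrB (hub a)).1]
        exact u.injOn (hus ▸ Set.mem_univ a) (hus ▸ Set.mem_univ 0) h1
      have hcont : Continuous fun a => e.symm (u a) :=
        e.continuousOn_symm.comp_continuous hucont fun a => (hrB (hub a)).1
      have hball : e.symm '' Metric.ball (e x) r ∈ 𝓝 x := by
        have := (e.symm.isOpen_image_of_subset_source Metric.isOpen_ball
          (fun a ha => (hrB ha).1)).mem_nhds ⟨e x, Metric.mem_ball_self hr, e.left_inv hxs⟩
        exact this
      have hrange : ∀ y ∈ e.symm '' Metric.ball (e x) r, ∃ a, e.symm (u a) = y := by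
        rintro _ ⟨a, ha, rfl⟩
        exact ⟨u.symm a, by rw [u.right_inv (hut ▸ ha)]⟩
      have hP : IsPreconnected ((fun a => e.symm (u a)) '' {0}ᶜ) := by
        refine IsPreconnected.image ?_ _ hcont.continuousOn
        refine (isConnected_compl_singleton_of_one_lt_rank ?_ _).isPreconnected
        rw [rank_eq_card_basis (EuclideanSpace.basisFun (Fin n) ℝ).toBasis]
        simpa using Nat.lt_of_succ_le hn
      have hPΩ : (fun a => e.symm (u a)) '' {0}ᶜ ⊆ V \ D := by
        rintro _ ⟨a, ha, rfl⟩
        exact ⟨(hrB (hub a)).2.2, fun hc => ha (hjinj a (hU (hrB (hub a)).2.1 hc))⟩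
      have hPO : (fun a => e.symm (u a)) '' {0}ᶜ ⊆ O := by
        refine hP.subset_of_closure_inter_subset hOopen ?_ fun y hy =>
          hOclosed ⟨hy.1, hPΩ hy.2⟩
        obtain ⟨o, ho, hoO⟩ := mem_closure_iff_nhds.1 hx _ hball
        obtain ⟨a, rfl⟩ := hrange o ho
        refine ⟨_, ⟨a, fun ha => hoO.1.2 ?_, rfl⟩, hoO⟩
        rw [Set.mem_singleton_iff.1 ha, hu0, e.left_inv hxs]
        exact hxD
      filter_upwards [hball] with y hy
      obtain ⟨a, rfl⟩ := hrange y hy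
      by_cases ha : a = 0
      · rw [ha, hu0, e.left_inv hxs]
        exact hx
      · exact subset_closure (hPO ⟨a, ha, rfl⟩)
    · exact Filter.mem_of_superset (hOopen.mem_nhds (hOclosed ⟨hx, hclV hx, hxD⟩)) subset_closure
  obtain ⟨y, hy, hyR⟩ := hcomp q
  have hqO : q ∈ O := ⟨hq, id, IsPush.id _, rfl⟩
  exact hyR (closure_minimal hOR hR (hclopen.connectedComponent_subset (subset_closure hqO) hy))

end Push

/-! ### Avoiding a value on `R`, and necessity -/

section Avoid

/-- Stereographic projection from `p`, as a smooth chart of the sphere. -/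
theorem exists_chart_compl_singleton {n : ℕ} (p : UnitSphere n) :
    ∃ e ∈ atlas (EuclideanSpace ℝ (Fin n)) (UnitSphere n), e.source = {p}ᶜ ∧
      e.target = Set.univ :=
  haveI := Fact.mk (@finrank_euclideanSpace_fin ℝ _ (n + 1))
  ⟨stereographic' n p, ⟨p, rfl⟩, stereographic'_source p, stereographic'_target p⟩

variable {n : ℕ} {M : Type*} [TopologicalSpace M] [ChartedSpace (EuclideanSpace ℝ (Fin n)) M]
  [IsManifold (𝓡 n) ∞ M]

/-- In a chart, and with values in the ambient space, the differential is bounded below, which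
isolates `x` in its fibre. -/
theorem eventually_eq_imp_eq_of_mfderiv_injective {F : M → UnitSphere n}
    (hF : ContMDiff (𝓡 n) (𝓡 n) ∞ F) {x : M}
    (hx : Function.Injective (mfderiv (𝓡 n) (𝓡 n) F x)) :
    ∀ᶠ y in 𝓝 x, F y = F x → y = x := by
  set e := chartAt (EuclideanSpace ℝ (Fin n)) x with he
  have heD := mdifferentiable_chart (I := 𝓡 n) x
  have hxs : x ∈ e.source := mem_chart_source _ x
  have hxt := e.map_source hxs
  let g : EuclideanSpace ℝ (Fin n) → EuclideanSpace ℝ (Fin (n + 1)) :=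
    (Subtype.val ∘ F) ∘ e.symm
  have hval : MDifferentiableAt (𝓡 n) 𝓘(ℝ, EuclideanSpace ℝ (Fin (n + 1)))
      (Subtype.val : UnitSphere n → EuclideanSpace ℝ (Fin (n + 1))) (F x) :=
    (contMDiff_unitSphere_val n 1).mdifferentiableAt one_ne_zero
  have hFx : MDifferentiableAt (𝓡 n) (𝓡 n) F x := hF.mdifferentiableAt (by simp)
  have hleft : e.symm (e x) = x := e.left_inv hxs
  have hgM : MDifferentiableAt (𝓡 n) 𝓘(ℝ, EuclideanSpace ℝ (Fin (n + 1))) g (e x) := by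
    refine MDifferentiableAt.comp _ ?_ (heD.mdifferentiableAt_symm hxt)
    rw [hleft]
    exact hval.comp x hFx
  have hgd : Function.Injective (fderiv ℝ g (e x)) := by
    have h1 : mfderiv (𝓡 n) 𝓘(ℝ, EuclideanSpace ℝ (Fin (n + 1))) g (e x) = _ :=
      mfderiv_comp (e x) (by rw [hleft]; exact hval.comp x hFx) (heD.mdifferentiableAt_symm hxt)
    have h2 : mfderiv (𝓡 n) 𝓘(ℝ, EuclideanSpace ℝ (Fin (n + 1))) (Subtype.val ∘ F) x = _ :=
      mfderiv_comp x hval hFx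
    have h3 : Function.Injective (mfderiv (𝓡 n) 𝓘(ℝ, EuclideanSpace ℝ (Fin (n + 1)))
        (Subtype.val ∘ F) (e.symm (e x))) := by
      rw [hleft, h2]
      exact (mfderiv_unitSphere_val_injective (F x)).comp hx
    rw [mfderiv_eq_fderiv] at h1
    rw [h1]
    exact h3.comp (heD.symm.mfderiv_injective hxt)
  obtain ⟨K, -, hK⟩ := (fderiv ℝ g (e x)).toLinearMap.exists_antilipschitzWith
    (LinearMap.ker_eq_bot.2 hgd)
  have hne := (mdifferentiableAt_iff_differentiableAt.1 hgM).hasFDerivAt.eventually_ne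
    (c := g (e x)) ⟨K, hK⟩
  have hne' := eventually_nhdsWithin_iff.1 hne
  filter_upwards [(e.continuousAt hxs).eventually hne', e.open_source.mem_nhds hxs] with y hy hys hFy
  by_contra hyx
  refine hy (fun hc => hyx (e.injOn hys hxs hc)) ?_
  simp [g, e.left_inv hys, hleft, hFy]

variable [CompactSpace M]

theorem finite_inter_fibre {F : M → UnitSphere n} (hF : ContMDiff (𝓡 n) (𝓡 n) ∞ F)
    {R : Set M} (hR : IsClosed R)
    (hFR : ∀ x ∈ R, Function.Injective (mfderiv (𝓡 n) (𝓡 n) F x)) (p : UnitSphere n) :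
    (R ∩ F ⁻¹' {p}).Finite := by
  refine (hR.inter (isClosed_singleton.preimage hF.continuous)).isCompact.finite ?_
  refine isDiscrete_iff_forall_mem_exists_isOpen.2 fun x hx => ?_
  obtain ⟨u, hu, huo, hxu⟩ := mem_nhds_iff.1
    (eventually_eq_imp_eq_of_mfderiv_injective hF (hFR x hx.1))
  refine ⟨u, huo, Set.Subset.antisymm ?_ (Set.singleton_subset_iff.2 ⟨hxu, hx⟩)⟩
  exact fun y hy => hu hy.1 (hy.2.2.trans hx.2.symm)

variable [T2Space M]

/-- A map that is immersive near `R` can be modified to avoid a given value on `R`, provided `R`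
contains no component of `M`. -/
theorem exists_avoiding (hn : 2 ≤ n) {R V : Set M} (hR : IsClosed R) (hV : IsOpen V)
    (hRV : R ⊆ V) (hcomp : ∀ x, ∃ y ∈ connectedComponent x, y ∉ R) (p : UnitSphere n)
    {F : M → UnitSphere n} (hF : ContMDiff (𝓡 n) (𝓡 n) ∞ F)
    (hFV : ∀ x ∈ V, Function.Injective (mfderiv (𝓡 n) (𝓡 n) F x)) :
    ∃ G : M → UnitSphere n, ContMDiff (𝓡 n) (𝓡 n) ∞ G ∧
      (∀ x ∈ V, Function.Injective (mfderiv (𝓡 n) (𝓡 n) G x)) ∧ ∀ x ∈ R, G x ≠ p := by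
  induction hk : (R ∩ F ⁻¹' {p}).ncard using Nat.strong_induction_on generalizing F with
  | _ k ih =>
    by_cases hempty : R ∩ F ⁻¹' {p} = ∅
    · exact ⟨F, hF, hFV, fun x hx hxp => by
        have : x ∈ R ∩ F ⁻¹' {p} := ⟨hx, hxp⟩
        simp [hempty] at this⟩
    · obtain ⟨q, hqR, hqp⟩ := Set.nonempty_iff_ne_empty.2 hempty
      -- The rest of the fibre in all of `V`, not only in `R`: a push fixing `D` maps `V \ D` to
      -- itself, so there it can reach the fibre only at `q`.
      set D : Set M := (V ∩ F ⁻¹' {p}) \ {q} with hDdef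
      have hloc : ∀ x ∈ V, ∀ᶠ y in 𝓝 x, F y = F x → y = x := fun x hx =>
        eventually_eq_imp_eq_of_mfderiv_injective hF (hFV x hx)
      have hD : ∀ d ∈ D ∩ V, ∀ᶠ x in 𝓝 d, x ∈ D → x = d := by
        rintro d ⟨⟨⟨hdV, hdp⟩, -⟩, -⟩
        filter_upwards [hloc d hdV] with x hx hxD
        exact hx (hxD.1.2.trans hdp.symm)
      have hΩ : IsOpen (V \ D) := by
        refine isOpen_iff_mem_nhds.2 fun x hx => ?_
        by_cases hxp : F x = p
        · filter_upwards [hV.mem_nhds hx.1, hloc x hx.1] with y hyV hy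
          refine ⟨hyV, fun hyD => hx.2 ?_⟩
          rwa [hy (hyD.1.2.trans hxp.symm)] at hyD
        · filter_upwards [hV.mem_nhds hx.1,
            (isClosed_singleton.preimage hF.continuous).isOpen_compl.mem_nhds hxp] with y hyV hy
          exact ⟨hyV, fun hyD => hy hyD.1.2⟩
      have hqΩ : q ∈ V \ D := ⟨hRV hqR, fun h => h.2 rfl⟩
      obtain ⟨z, hzΩ, hzR, h, hh, hhz⟩ :=
        exists_push_notMem hn hR hV hRV hcomp hΩ hD hqΩ
      have hhV : Set.MapsTo h V V := by
        intro x hx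
        by_cases hxΩ : x ∈ V \ D
        · exact (hh.mapsTo hxΩ).1
        · rwa [hh.eq_self x hxΩ]
      -- The only point of `V \ D` sent to `q` is `z`, which lies outside `R`; no new fibre point
      -- arises in `R`, and `q` is lost.
      have hsub : R ∩ (F ∘ h) ⁻¹' {p} ⊂ R ∩ F ⁻¹' {p} := by
        have hmem : ∀ x ∈ R ∩ (F ∘ h) ⁻¹' {p}, x ∈ D := by
          rintro x ⟨hxR, hxp⟩
          by_contra hxD
          have hxΩ : x ∈ V \ D := ⟨hRV hxR, hxD⟩
          have h1 := hh.mapsTo hxΩ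
          have h2 : h x = q := by
            by_contra hne
            exact h1.2 ⟨⟨h1.1, hxp⟩, hne⟩
          exact hzR (hh.injective (h2.trans hhz.symm) ▸ hxR)
        refine ⟨fun x hx => ⟨hx.1, (hmem x hx).1.2⟩, fun hc => ?_⟩
        exact (hmem q (hc ⟨hqR, hqp⟩)).2 rfl
      refine ih _ (hk ▸ Set.ncard_lt_ncard hsub
        (finite_inter_fibre hF hR (fun x hx => hFV x (hRV hx)) p)) (hF.comp hh.contMDiff) ?_ rfl
      intro x hx
      rw [mfderiv_comp x (hF.mdifferentiableAt (by simp))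
        (hh.contMDiff.mdifferentiableAt (by simp))]
      exact (hFV _ (hhV hx)).comp (hh.mfderiv_injective x)

theorem exists_immersion_nhds (hn : 2 ≤ n) {R V : Set M} (hR : IsClosed R) (hV : IsOpen V)
    (hRV : R ⊆ V) (hcomp : ∀ x, ∃ y ∈ connectedComponent x, y ∉ R)
    {F : M → UnitSphere n} (hF : ContMDiff (𝓡 n) (𝓡 n) ∞ F)
    (hFV : ∀ x ∈ V, Function.Injective (mfderiv (𝓡 n) (𝓡 n) F x)) :
    ∃ U : TopologicalSpace.Opens M, R ⊆ (U : Set M) ∧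
      ∃ f : U → EuclideanSpace ℝ (Fin n), Manifold.IsImmersion (𝓡 n) (𝓡 n) ∞ f := by
  let p : UnitSphere n := ⟨EuclideanSpace.single 0 1, by simp⟩
  obtain ⟨G, hG, hGV, hGR⟩ := exists_avoiding hn hR hV hRV hcomp p hF hFV
  obtain ⟨e, he, hes, -⟩ := exists_chart_compl_singleton p
  have heD : e.MDifferentiable (𝓡 n) (𝓡 n) := mdifferentiable_of_mem_atlas he
  let U : TopologicalSpace.Opens M :=
    ⟨V ∩ G ⁻¹' {p}ᶜ, hV.inter (isOpen_compl_singleton.preimage hG.continuous)⟩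
  have hUe : ∀ x : U, G x ∈ e.source := fun x => hes ▸ x.2.2
  have hGU : ContMDiff (𝓡 n) (𝓡 n) ∞ (fun x : U => G x) := hG.comp contMDiff_subtype_val
  refine ⟨U, fun x hx => ⟨hRV hx, hGR x hx⟩, fun x => e (G x),
    isImmersion_of_mfderiv_injective ?_ fun x => ?_⟩
  · exact (contMDiffOn_of_mem_maximalAtlas (IsManifold.subset_maximalAtlas he)).comp_contMDiff
      hGU hUe
  · have hval : MDifferentiableAt (𝓡 n) (𝓡 n) (Subtype.val : U → M) x :=
      contMDiff_subtype_val.mdifferentiableAt one_ne_zero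
    have hGx : MDifferentiableAt (𝓡 n) (𝓡 n) G x := hG.mdifferentiableAt (by simp)
    have h1 : mfderiv (𝓡 n) (𝓡 n) (e ∘ (G ∘ Subtype.val)) x = _ :=
      mfderiv_comp x (heD.mdifferentiableAt (hUe x)) (hGx.comp x hval)
    have h2 : mfderiv (𝓡 n) (𝓡 n) (G ∘ (Subtype.val : U → M)) x = _ := mfderiv_comp x hGx hval
    have h3 : Function.Injective (mfderiv (𝓡 n) (𝓡 n) (Subtype.val : U → M) x) :=
      mfderiv_injective_of_isImmersionAt ((Manifold.IsImmersion.of_opens U).isImmersionAt x)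
    change Function.Injective (mfderiv (𝓡 n) (𝓡 n) (e ∘ (G ∘ Subtype.val)) x)
    rw [h1, h2]
    exact (heD.mfderiv_injective (hUe x)).comp ((hGV _ x.2.1).comp h3)

end Avoid

/-! ### From an immersion of an open subset to a map on `M` -/

section ImmersionExtension

variable {n : ℕ} {M : Type*} [TopologicalSpace M] [ChartedSpace (EuclideanSpace ℝ (Fin n)) M]

theorem injective_of_comp_injective (A B : EuclideanSpace ℝ (Fin n) →L[ℝ] EuclideanSpace ℝ (Fin n))
    (h : Function.Injective (A.comp B)) : Function.Injective A := by
  have hB : Function.Surjective B :=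
    (LinearMap.injective_iff_surjective (f := B.toLinearMap)).1 (Function.Injective.of_comp h)
  exact Function.Injective.of_comp_right h hB

theorem exists_extension_of_isImmersion {V : TopologicalSpace.Opens M}
    {f : V → EuclideanSpace ℝ (Fin n)} (hf : Manifold.IsImmersion (𝓡 n) (𝓡 n) ∞ f) :
    ∃ F : M → EuclideanSpace ℝ (Fin n), ∀ x ∈ V, ContMDiffAt (𝓡 n) (𝓡 n) ∞ F x ∧
      Function.Injective (mfderiv (𝓡 n) (𝓡 n) F x) := by
  let F : M → EuclideanSpace ℝ (Fin n) := Function.extend Subtype.val f 0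
  have hF : F ∘ Subtype.val = f := funext fun x => Subtype.val_injective.extend_apply _ _ _
  refine ⟨F, fun x hx => ?_⟩
  have hFx : ContMDiffAt (𝓡 n) (𝓡 n) ∞ F x := by
    refine (contMDiffAt_subtype_iff (U := V) (x := ⟨x, hx⟩)).1 ?_
    have := (hf.isImmersionAt ⟨x, hx⟩).contMDiffAt
    rwa [← hF] at this
  refine ⟨hFx, ?_⟩
  have h1 : mfderiv (𝓡 n) (𝓡 n) (F ∘ (Subtype.val : V → M)) ⟨x, hx⟩ = _ :=
    mfderiv_comp (⟨x, hx⟩ : V) (hFx.mdifferentiableAt (by simp))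
      (contMDiff_subtype_val.mdifferentiableAt one_ne_zero)
  have h2 := mfderiv_injective_of_isImmersionAt (hf.isImmersionAt ⟨x, hx⟩)
  rw [← hF, h1] at h2
  exact injective_of_comp_injective _ _ h2

end ImmersionExtension

/-! ### Orientations and orientation preserving immersions -/

section Orientation

/-- The determinant form of `ℝ^n`. -/
abbrev stdDet (n : ℕ) : EuclideanSpace ℝ (Fin n) [⋀^Fin n]→ₗ[ℝ] ℝ :=
  (EuclideanSpace.basisFun (Fin n) ℝ).toBasis.det

theorem stdDet_ne_zero {n : ℕ} {v : Fin n → EuclideanSpace ℝ (Fin n)}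
    (hv : LinearIndependent ℝ v) : stdDet n v ≠ 0 :=
  ((Module.Basis.is_basis_iff_det _).1
    ⟨hv, hv.span_eq_top_of_card_eq_finrank' (by simp)⟩).ne_zero

theorem exists_orientation_reversing {n : ℕ} (hn : 2 ≤ n) :
    ∃ A : EuclideanSpace ℝ (Fin n) ≃L[ℝ] EuclideanSpace ℝ (Fin n),
      ∀ v : Fin n → EuclideanSpace ℝ (Fin n), stdDet n (fun i => A (v i)) = -stdDet n v := by
  let b := (EuclideanSpace.basisFun (Fin n) ℝ).toBasis
  let i : Fin n := ⟨0, by omega⟩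
  let j : Fin n := ⟨1, by omega⟩
  have hij : i ≠ j := by simp [i, j]
  let A := (b.equiv b (Equiv.swap i j))
  refine ⟨A.toContinuousLinearEquiv, fun v => ?_⟩
  have h1 : (stdDet n).compLinearMap A.toLinearMap b = -1 := by
    have : (fun k => A.toLinearMap (b k)) = b ∘ Equiv.swap i j := by
      ext1 k
      simp [A]
    rw [AlternatingMap.compLinearMap_apply, this, AlternatingMap.map_swap _ _ hij,
      Module.Basis.det_self]
  have h2 := AlternatingMap.eq_smul_basis_det b ((stdDet n).compLinearMap A.toLinearMap)
  rw [h1] at h2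
  have h3 := DFunLike.congr_fun h2 v
  rw [AlternatingMap.smul_apply, neg_one_smul] at h3
  exact h3

theorem formNonneg_iff {n : ℕ} {E : Type*} [AddCommGroup E] [Module ℝ E]
    {b : Module.Basis (Fin n) ℝ E} {o : Orientation ℝ E (Fin n)} (hb : b.orientation = o)
    {η : E [⋀^Fin n]→ₗ[ℝ] ℝ} : FormNonneg o η ↔ 0 ≤ η b := by
  refine ⟨fun h => h b hb, fun h b' hb' => ?_⟩
  rw [AlternatingMap.eq_smul_basis_det b η]
  exact mul_nonneg h ((b.orientation_eq_iff_det_pos b').1 (hb.trans hb'.symm)).le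

variable {n : ℕ} {M : Type*} [TopologicalSpace M] [ChartedSpace (EuclideanSpace ℝ (Fin n)) M]
  [IsManifold (𝓡 n) ∞ M]

theorem ManifoldOrientation.exists_oriented_localFrame (hn : n ≠ 0) (o : ManifoldOrientation n M)
    (x₀ : M) : ∃ β : Module.Basis (Fin n) ℝ (EuclideanSpace ℝ (Fin n)), ∀ᶠ x in 𝓝 x₀,
      ∃ b : Module.Basis (Fin n) ℝ (TangentSpace (𝓡 n) x), ⇑b = localFrame x₀ β x ∧
        b.orientation = o.at_point x := by
  have : Nonempty (Fin n) := ⟨⟨0, Nat.pos_of_ne_zero hn⟩⟩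
  obtain ⟨oE, hoE⟩ := o.locally_constant x₀
  refine ⟨oE.someBasis (by simp), ?_⟩
  filter_upwards [hoE, eventually_mem_baseSet (n := n) x₀] with x hx hxb
  refine ⟨_, (localFrame_eq_map hxb _).symm, ?_⟩
  rw [Module.Basis.orientation_map, Orientation.someBasis_orientation, ← hx hxb,
    ← Orientation.map_symm, Equiv.symm_apply_apply]

/-- The sign of the Jacobian is locally constant on `V`, so composing with a reflection exactly
where it is negative keeps the map smooth. -/
theorem exists_orientation_preserving (hn : 2 ≤ n) (o : ManifoldOrientation n M) {V : Set M}
    {F : M → EuclideanSpace ℝ (Fin n)}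
    (hF : ∀ x ∈ V, ContMDiffAt (𝓡 n) (𝓡 n) ∞ F x)
    (hinj : ∀ x ∈ V, Function.Injective (mfderiv (𝓡 n) (𝓡 n) F x)) :
    ∃ G : M → EuclideanSpace ℝ (Fin n), (∀ x ∈ V, ContMDiffAt (𝓡 n) (𝓡 n) ∞ G x) ∧
      ∀ x ∈ V, ∀ b : Module.Basis (Fin n) ℝ (TangentSpace (𝓡 n) x),
        b.orientation = o.at_point x →
          0 < stdDet n fun i => mfderiv (𝓡 n) (𝓡 n) G x (b i) := by
  classical
  obtain ⟨A, hA⟩ := exists_orientation_reversing hn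
  let η : ∀ x, TangentSpace (𝓡 n) x [⋀^Fin n]→ₗ[ℝ] ℝ := fun x =>
    (stdDet n).compLinearMap (mfderiv (𝓡 n) (𝓡 n) F x).toLinearMap
  have hη : ∀ x ∈ V, ∀ b : Module.Basis (Fin n) ℝ (TangentSpace (𝓡 n) x), η x b ≠ 0 :=
    fun x hx b => stdDet_ne_zero (b.linearIndependent.map'
      (mfderiv (𝓡 n) (𝓡 n) F x).toLinearMap (LinearMap.ker_eq_bot.2 (hinj x hx)))
  let P : M → Prop := fun x => FormNonneg (o.at_point x) (η x)
  have hP : ∀ x ∈ V, ∀ᶠ y in 𝓝 x, (P y ↔ P x) := by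
    intro x hx
    obtain ⟨β, hβ⟩ := o.exists_oriented_localFrame (by omega) x
    have hcont := continuousAt_det_mfderiv_localFrame (hF x hx) β
    obtain ⟨bx, hbx, hbxo⟩ := hβ.self_of_nhds
    have hne : η x (localFrame x β x) ≠ 0 := hbx ▸ hη x hx bx
    rcases lt_or_gt_of_ne hne with hlt | hgt
    · filter_upwards [hβ, hcont.eventually_lt_const hlt] with y hy hylt
      obtain ⟨b, hb, hbo⟩ := hy
      change FormNonneg _ _ ↔ FormNonneg _ _
      rw [formNonneg_iff hbo, formNonneg_iff hbxo, hb, hbx]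
      exact iff_of_false (not_le.2 hylt) (not_le.2 hlt)
    · filter_upwards [hβ, hcont.eventually_const_lt hgt] with y hy hylt
      obtain ⟨b, hb, hbo⟩ := hy
      change FormNonneg _ _ ↔ FormNonneg _ _
      rw [formNonneg_iff hbo, formNonneg_iff hbxo, hb, hbx]
      exact iff_of_true hylt.le hgt.le
  let G : M → EuclideanSpace ℝ (Fin n) := fun x => if P x then F x else A (F x)
  have hGP : ∀ x ∈ V, P x → G =ᶠ[𝓝 x] F := fun x hx hPx => by
    filter_upwards [hP x hx] with y hy using if_pos (hy.2 hPx)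
  have hGN : ∀ x ∈ V, ¬P x → G =ᶠ[𝓝 x] A ∘ F := fun x hx hPx => by
    filter_upwards [hP x hx] with y hy using if_neg fun h => hPx (hy.1 h)
  refine ⟨G, fun x hx => ?_, fun x hx b hb => ?_⟩
  · by_cases hPx : P x
    · exact (hF x hx).congr_of_eventuallyEq (hGP x hx hPx)
    · exact (A.contDiff.contMDiff.contMDiffAt.comp x (hF x hx)).congr_of_eventuallyEq
        (hGN x hx hPx)
  · by_cases hPx : P x
    · rw [(hGP x hx hPx).mfderiv_eq]
      exact lt_of_le_of_ne (hPx b hb) (hη x hx b).symm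
    · have h1 : mfderiv (𝓡 n) (𝓡 n) (A ∘ F) x = _ := mfderiv_comp x
        A.mdifferentiableAt ((hF x hx).mdifferentiableAt (by simp))
      rw [(hGN x hx hPx).mfderiv_eq, h1, A.mfderiv_eq]
      have h2 : stdDet n (fun i => A (mfderiv (𝓡 n) (𝓡 n) F x (b i))) = -η x b := hA _
      refine lt_of_lt_of_eq (neg_pos.2 ?_) h2.symm
      exact not_le.1 fun h => hPx ((formNonneg_iff hb).2 h)

end Orientation

/-! ### An orientation preserving chart of the punctured sphere -/

section SphereParametrization

variable {n : ℕ}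

/-- The value at `w` of the pullback of the volume form by a map `ℝ^n → S^n`, on the standard
basis. -/
def pullbackDensity (ι : EuclideanSpace ℝ (Fin n) → UnitSphere n)
    (w : EuclideanSpace ℝ (Fin n)) : ℝ :=
  pullbackVolumeForm ι w ((EuclideanSpace.basisFun (Fin n) ℝ).toBasis :
    Fin n → EuclideanSpace ℝ (Fin n))

theorem continuous_pullbackDensity {ι : EuclideanSpace ℝ (Fin n) → UnitSphere n}
    (hι : ContMDiff (𝓡 n) (𝓡 n) ∞ ι) : Continuous (pullbackDensity ι) := by
  refine continuous_iff_continuousAt.2 fun w => ?_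
  refine (continuousAt_pullbackVolumeForm_localFrame hι
    (EuclideanSpace.basisFun (Fin n) ℝ).toBasis).congr (Filter.Eventually.of_forall fun z => ?_)
  refine congrArg (pullbackVolumeForm ι z) (funext fun i => ?_)
  rw [localFrame, TangentBundle.symmL_model_space]
  rfl

theorem pullbackVolumeForm_comp {M : Type*} [TopologicalSpace M]
    [ChartedSpace (EuclideanSpace ℝ (Fin n)) M]
    {ι : EuclideanSpace ℝ (Fin n) → UnitSphere n} {G : M → EuclideanSpace ℝ (Fin n)} {x : M}
    (hι : MDifferentiableAt (𝓡 n) (𝓡 n) ι (G x)) (hG : MDifferentiableAt (𝓡 n) (𝓡 n) G x)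
    (v : Fin n → TangentSpace (𝓡 n) x) :
    pullbackVolumeForm (ι ∘ G) x v =
      pullbackDensity ι (G x) * stdDet n fun i => mfderiv (𝓡 n) (𝓡 n) G x (v i) := by
  have h1 : pullbackVolumeForm (ι ∘ G) x v =
      pullbackVolumeForm ι (G x) fun i => mfderiv (𝓡 n) (𝓡 n) G x (v i) := by
    simp only [pullbackVolumeForm]
    rw [mfderiv_comp x hι hG]
    rfl
  rw [h1]
  exact DFunLike.congr_fun (AlternatingMap.eq_smul_basis_det
    (EuclideanSpace.basisFun (Fin n) ℝ).toBasis (pullbackVolumeForm ι (G x))) _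

/-- An orientation preserving embedding of `ℝ^n` into `S^n` which is not onto. -/
theorem exists_sphere_parametrization (hn : 2 ≤ n) :
    ∃ ι : EuclideanSpace ℝ (Fin n) → UnitSphere n, ContMDiff (𝓡 n) (𝓡 n) ∞ ι ∧
      (∀ w, 0 < pullbackDensity ι w) ∧ ∃ y, ∀ w, ι w ≠ y := by
  let p : UnitSphere n := ⟨EuclideanSpace.single 0 1, by simp⟩
  obtain ⟨e, he, hes, het⟩ := exists_chart_compl_singleton p
  have heD : e.MDifferentiable (𝓡 n) (𝓡 n) := mdifferentiable_of_mem_atlas he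
  have hι : ContMDiff (𝓡 n) (𝓡 n) ∞ e.symm := by
    rw [← contMDiffOn_univ, ← het]
    exact contMDiffOn_symm_of_mem_maximalAtlas (IsManifold.subset_maximalAtlas he)
  have hp : ∀ w, e.symm w ≠ p := fun w => by
    have : e.symm w ∈ e.source := e.map_target (het ▸ Set.mem_univ w)
    rwa [hes] at this
  have hne : ∀ w, pullbackDensity e.symm w ≠ 0 := fun w =>
    pullbackVolumeForm_apply_ne_zero (heD.symm.mfderiv_injective (by simp [het]))
      (EuclideanSpace.basisFun (Fin n) ℝ).toBasis.linearIndependent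
  have hcont := continuous_pullbackDensity hι
  -- A continuous nowhere zero function on the connected space `ℝ^n` has constant sign.
  have hsign : (∀ w, 0 < pullbackDensity e.symm w) ∨ ∀ w, pullbackDensity e.symm w < 0 := by
    by_contra! hc
    obtain ⟨⟨a, ha⟩, b, hb⟩ := hc
    obtain ⟨c, hc⟩ := mem_range_of_exists_le_of_exists_ge hcont ⟨a, ha⟩ ⟨b, hb⟩
    exact hne c hc
  rcases hsign with h | h
  · exact ⟨e.symm, hι, h, p, hp⟩
  · obtain ⟨A, hA⟩ := exists_orientation_reversing hn
    refine ⟨e.symm ∘ A, hι.comp A.contDiff.contMDiff, fun w => ?_, p, fun w => hp _⟩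
    refine lt_of_lt_of_eq (mul_pos_of_neg_of_neg (h (A w)) ?_)
      (pullbackVolumeForm_comp (hι.mdifferentiableAt (by simp)) A.mdifferentiableAt _).symm
    rw [A.mfderiv_eq]
    refine lt_of_eq_of_lt (hA _) (neg_neg_of_pos ?_)
    rw [Module.Basis.det_self]
    exact one_pos

end SphereParametrization

/-! ### Small perturbation, and sufficiency -/

section Perturbation

variable {n : ℕ} {M : Type*} [TopologicalSpace M] [ChartedSpace (EuclideanSpace ℝ (Fin n)) M]

theorem pullbackVolumeForm_comp_smul
    {ι : EuclideanSpace ℝ (Fin n) → UnitSphere n} (hι : ContMDiff (𝓡 n) (𝓡 n) ∞ ι)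
    {g : M → EuclideanSpace ℝ (Fin n)} (hg : ContMDiff (𝓡 n) (𝓡 n) ∞ g) (ε : ℝ) (x : M)
    (v : Fin n → TangentSpace (𝓡 n) x) :
    pullbackVolumeForm (fun z => ι (ε • g z)) x v = pullbackDensity ι (ε • g x) *
      (ε ^ n * stdDet n fun i => mfderiv (𝓡 n) (𝓡 n) g x (v i)) := by
  have hgx : MDifferentiableAt (𝓡 n) (𝓡 n) g x := hg.mdifferentiableAt (by simp)
  refine (pullbackVolumeForm_comp (hι.mdifferentiableAt (by simp))
    (hgx.const_smul ε) v).trans ?_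
  rw [const_smul_mfderiv hgx]
  congr 1
  refine ((stdDet n).map_smul_univ (fun _ => ε) _).trans ?_
  simp

variable [IsManifold (𝓡 n) ∞ M]

/-- A missed value is vacuously regular, with an empty signed count. -/
theorem hasDegree_zero_of_forall_ne (o : ManifoldOrientation n M) {φ : M → UnitSphere n}
    {y : UnitSphere n} (hy : ∀ x, φ x ≠ y) : HasDegree o φ 0 := by
  have hempty : φ ⁻¹' {y} = ∅ := Set.eq_empty_of_forall_notMem hy
  refine ⟨y, fun x hx => absurd hx (hy x), ?_, ?_⟩
  · simp [hempty]
  · simp [signedFibreCount, hempty]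

theorem exists_contMDiff_eventuallyEq [T2Space M] [CompactSpace M] {R V : Set M}
    (hR : IsClosed R) (hV : IsOpen V) (hRV : R ⊆ V) {G : M → EuclideanSpace ℝ (Fin n)}
    (hG : ∀ x ∈ V, ContMDiffAt (𝓡 n) (𝓡 n) ∞ G x) :
    ∃ g : M → EuclideanSpace ℝ (Fin n), ContMDiff (𝓡 n) (𝓡 n) ∞ g ∧ ∀ x ∈ R, g =ᶠ[𝓝 x] G := by
  obtain ⟨u, huo, hRu, huV⟩ := normal_exists_closure_subset hR hV hRV
  obtain ⟨χ, hχ1, hχ0, -⟩ := exists_contMDiffMap_one_nhds_of_subset_interior (𝓡 n) (n := ⊤) hR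
    (hRu.trans (interior_maximal subset_closure huo))
  refine ⟨fun x => χ x • G x, fun x => ?_, fun x hx => ?_⟩
  · by_cases hx : x ∈ V
    · exact χ.contMDiff.contMDiffAt.smul (hG x hx)
    · have : (fun x => χ x • G x) =ᶠ[𝓝 x] fun _ => 0 := by
        filter_upwards [isClosed_closure.isOpen_compl.mem_nhds fun hc => hx (huV hc)] with z hz
        rw [hχ0 z hz, zero_smul]
      exact contMDiffAt_const.congr_of_eventuallyEq this
  · filter_upwards [eventually_nhdsSet_iff_forall.1 hχ1 x hx] with z hz
    rw [hz, one_smul]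

theorem exists_small_map_sum_ne_zero [T2Space M] [CompactSpace M] (hn : 2 ≤ n)
    (o : ManifoldOrientation n M) {φ : M → UnitSphere n} (hφ : ContMDiff (𝓡 n) (𝓡 n) ∞ φ)
    (hnonneg : ∀ x, FormNonneg (o.at_point x) (pullbackVolumeForm φ x))
    {V : TopologicalSpace.Opens M} (hRV : {x | pullbackVolumeForm φ x = 0} ⊆ (V : Set M))
    {f : V → EuclideanSpace ℝ (Fin n)} (hf : Manifold.IsImmersion (𝓡 n) (𝓡 n) ∞ f) :
    ∃ ψ : M → UnitSphere n, ContMDiff (𝓡 n) (𝓡 n) ∞ ψ ∧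
      (∀ x, pullbackVolumeForm φ x + pullbackVolumeForm ψ x ≠ 0) ∧ HasDegree o ψ 0 := by
  have hR : IsClosed {x | pullbackVolumeForm φ x = 0} := by
    have := (isOpen_pullbackVolumeForm_ne_zero hφ).isClosed_compl
    simpa [Set.compl_ofPred] using this
  obtain ⟨F, hF⟩ := exists_extension_of_isImmersion hf
  obtain ⟨G, hG, hGpos⟩ := exists_orientation_preserving hn o (V := V) (fun x hx => (hF x hx).1)
    fun x hx => (hF x hx).2
  obtain ⟨g, hg, hgG⟩ := exists_contMDiff_eventuallyEq hR V.isOpen hRV hG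
  obtain ⟨ι, hι, hιpos, y, hy⟩ := exists_sphere_parametrization hn
  -- Joint neighbourhoods of `(0, x₀)` let compactness of `M` give one `ε` for all points; the
  -- condition `0 < z.1` excludes `ε = 0`, where the sum still vanishes on `R`.
  have hlocal : ∀ x₀ ∈ (Set.univ : Set M), ∀ᶠ z : ℝ × M in 𝓝 ((0 : ℝ), x₀), 0 < z.1 →
      pullbackVolumeForm φ z.2 + pullbackVolumeForm (fun x => ι (z.1 • g x)) z.2 ≠ 0 := by
    intro x₀ _
    obtain ⟨β, hβ⟩ := o.exists_oriented_localFrame (by omega) x₀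
    have hn0 : n ≠ 0 := by omega
    by_cases hx₀ : pullbackVolumeForm φ x₀ = 0
    · have hx : ∀ᶠ x in 𝓝 x₀, g =ᶠ[𝓝 x] G := (hgG x₀ hx₀).eventually_nhds
      have hxε : ∀ᶠ x in 𝓝 x₀, ∀ ε : ℝ, 0 < ε →
          pullbackVolumeForm φ x + pullbackVolumeForm (fun x => ι (ε • g x)) x ≠ 0 := by
        filter_upwards [hβ, hx, V.isOpen.mem_nhds (hRV hx₀)] with x hbx hgx hxV ε hε h0
        obtain ⟨b, -, hbo⟩ := hbx
        have h1 : 0 ≤ pullbackVolumeForm φ x b := hnonneg x b hbo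
        have h2 : 0 < pullbackVolumeForm (fun x => ι (ε • g x)) x b := by
          rw [pullbackVolumeForm_comp_smul hι hg, hgx.mfderiv_eq]
          exact mul_pos (hιpos _) (mul_pos (pow_pos hε n) (hGpos x hxV b hbo))
        exact (add_pos_of_nonneg_of_pos h1 h2).ne' (DFunLike.congr_fun h0 (b : Fin n → _))
      exact (continuousAt_snd.eventually hxε).mono fun z hz => hz z.1
    · obtain ⟨b, hb, -⟩ := hβ.self_of_nhds
      have hne : pullbackVolumeForm φ x₀ (localFrame x₀ β x₀) ≠ 0 := by
        rw [← hb]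
        exact pullbackVolumeForm_apply_ne_zero (pullbackVolumeForm_ne_zero_iff.1 hx₀)
          b.linearIndependent
      have hc1 : ContinuousAt (fun z : ℝ × M => pullbackVolumeForm φ z.2 (localFrame x₀ β z.2))
          (0, x₀) :=
        (continuousAt_pullbackVolumeForm_localFrame hφ β).comp_of_eq continuousAt_snd rfl
      have hc2 : ContinuousAt (fun z : ℝ × M => stdDet n fun i =>
          mfderiv (𝓡 n) (𝓡 n) g z.2 (localFrame x₀ β z.2 i)) (0, x₀) :=
        (continuousAt_det_mfderiv_localFrame hg.contMDiffAt β).comp_of_eq continuousAt_snd rfl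
      have hc3 : ContinuousAt (fun z : ℝ × M => pullbackDensity ι (z.1 • g z.2)) (0, x₀) :=
        ((continuous_pullbackDensity hι).comp
          (continuous_fst.smul (hg.continuous.comp continuous_snd))).continuousAt
      have hc := hc1.add (hc3.mul ((continuousAt_fst.pow n).mul hc2))
      -- At `ε = 0` the factor `ε ^ n` vanishes since `n ≠ 0`, leaving the nonzero value of the form
      -- of `φ`.
      filter_upwards [hc.eventually_ne (y := 0) (by simpa [hn0] using hne)] with z hz _ h0
      refine hz ?_
      have h3 := DFunLike.congr_fun h0 (localFrame x₀ β z.2)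
      rw [AlternatingMap.add_apply, pullbackVolumeForm_comp_smul hι hg] at h3
      exact h3
  have hall := isCompact_univ.eventually_forall_of_forall_eventually
    (x₀ := (0 : ℝ)) (P := fun ε x => 0 < ε →
      pullbackVolumeForm φ x + pullbackVolumeForm (fun x => ι (ε • g x)) x ≠ 0) hlocal
  obtain ⟨ε, hε, hεpos⟩ :=
    ((hall.filter_mono nhdsWithin_le_nhds).and (self_mem_nhdsWithin (s := Set.Ioi (0 : ℝ)))).exists
  have hεg : ContMDiff (𝓡 n) (𝓡 n) ∞ fun x => ε • g x :=
    (ε • ContinuousLinearMap.id ℝ (EuclideanSpace ℝ (Fin n))).contMDiff.comp hg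
  exact ⟨fun x => ι (ε • g x), hι.comp hεg,
    fun x => hε x (Set.mem_univ x) hεpos, hasDegree_zero_of_forall_ne o fun x => hy _⟩

end Perturbation

end

/-! ### The theorem in dimension four -/

theorem mainTheorem4 {M : Type*} [TopologicalSpace M] [T2Space M] [CompactSpace M]
    [ChartedSpace (EuclideanSpace ℝ (Fin 4)) M] [IsManifold (𝓡 4) ∞ M]
    (o : ManifoldOrientation 4 M)
    (φ : M → UnitSphere 4) (hφ : ContMDiff (𝓡 4) (𝓡 4) ∞ φ)
    (hnonneg : ∀ x, FormNonneg (o.at_point x) (pullbackVolumeForm φ x))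
    (hcomp : ∀ x, ∃ y ∈ connectedComponent x, pullbackVolumeForm φ y ≠ 0) :
    ((∃ φ' : M → UnitSphere 4, ContMDiff (𝓡 4) (𝓡 4) ∞ φ' ∧
        ∀ x, pullbackVolumeForm φ x + pullbackVolumeForm φ' x ≠ 0) ↔
      (∃ V : TopologicalSpace.Opens M, {x | pullbackVolumeForm φ x = 0} ⊆ (V : Set M) ∧
        ∃ f : V → EuclideanSpace ℝ (Fin 4), Manifold.IsImmersion (𝓡 4) (𝓡 4) ∞ f)) ∧
    ((∃ V : TopologicalSpace.Opens M, {x | pullbackVolumeForm φ x = 0} ⊆ (V : Set M) ∧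
        ∃ f : V → EuclideanSpace ℝ (Fin 4), Manifold.IsImmersion (𝓡 4) (𝓡 4) ∞ f) →
      ∃ φ' : M → UnitSphere 4, ContMDiff (𝓡 4) (𝓡 4) ∞ φ' ∧
        (∀ x, pullbackVolumeForm φ x + pullbackVolumeForm φ' x ≠ 0) ∧ HasDegree o φ' 0) := by
  refine ⟨⟨?_, fun ⟨V, hV, f, hf⟩ => ?_⟩, fun ⟨V, hV, f, hf⟩ =>
    exists_small_map_sum_ne_zero (by norm_num) o hφ hnonneg hV hf⟩
  · rintro ⟨ψ, hψ, hsum⟩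
    refine exists_immersion_nhds (by norm_num) ?_ (isOpen_pullbackVolumeForm_ne_zero hψ) ?_ hcomp
      hψ fun x hx => pullbackVolumeForm_ne_zero_iff.1 hx
    · simpa [Set.compl_ofPred] using (isOpen_pullbackVolumeForm_ne_zero hφ).isClosed_compl
    · intro x hx hx'
      have hx0 : pullbackVolumeForm φ x = 0 := hx
      exact hsum x (by rw [hx0, hx', add_zero])
  · obtain ⟨ψ, hψ, hsum, -⟩ := exists_small_map_sum_ne_zero (by norm_num) o hφ hnonneg hV hf
    exact ⟨ψ, hψ, hsum⟩
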